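/- **Setting.** Let $I$ be a finite set of resources, $T$ a finite set of arrival types, and $N$ a finite set of feasible configurations $(R,t)$ with $R\subseteq I$, $t\in T$; write $N_t$ for the set of configurations of type $t$. Each resource $i\in I$ has an objective $f_i:\mathbb{Z}_{\ge 0}^{N}\to\mathbb{R}$ on multisets of configurations that is monotone, satisfies $f_i(0)=0$, has diminishing returns, i.e. $f_i(x+\mathbf 1_e)-f_i(x)\le f_i(y+\mathbf 1_e)-f_i(y)$ whenever $y\le x$ coordinatewise and $e\in N$, and depends only on the multiplicities of configurations $(R,t)$ with $i\in R$. Post-allocation stochasticity: whenever a configuration $e=(R,t)$ is chosen, a random subset of $R$ becomes active, drawn from a given distribution depending on $e$ (with arbitrary correlation between the resources), independently across arrivals. Let $p_{i,e}$ be the probability that $i$ is active in $e$. The total reward is $\sum_{i\in I} f_i(X_i)$, where $X_i$ is the multiset of the chosen configurations in which $i$ is active. For a sequence $c=(e_1,\dots,e_n)$ of choices (where some arrivals may receive no configuration), let $$F_i(c)=\sum_{X}\ \prod_{v\in X}p_{i,e_v}\prod_{v\notin X}(1-p_{i,e_v})\; f_i\Big(\sum_{v\in X}\mathbf 1_{e_v}\Big),$$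 where $X$ ranges over the subsets of the arrivals that receive a configuration; this is the expected reward from $i$. Arrivals: there are $V$ arrivals, whose types $t_1,\dots,t_V$ are drawn independently from a probability distribution $\mathcal V$ on $T$ that is unknown to the online algorithm. At most one configuration, from $N_{t_v}$, is chosen for arrival $v$. *Non-adaptive Greedy* observes the types one at a time but never the outcomes. At arrival $v$, given its earlier choices $c$, it chooses some $e\in N_{t_v}$ that maximizes $\sum_{i\in I}\big(F_i(c,e)-F_i(c)\big)$, and nothing if $N_{t_v}=\emptyset$; ties are broken in any way that depends only on the types seen so far. Let $\mathrm{ALG}(t_1,\dots,t_V)=\sum_{i\in I}F_i(c)$ for its final sequence $c$ of choices. *The adaptive offline benchmark* $\mathrm{AOPT}(t_1,\dots,t_V)$ is the maximum expected total reward of a policy that knows the whole instance and all types $t_1,\dots,t_V$ in advance and processes each arrival at most once, in an adaptively chosen order, where each decision may depend on the active sets observed after the previous choices, but not on outcomes that are not yet realized. **Theorem.** For every such instance, every $V\ge 0$, every distribution $\mathcal V$ on $T$, and every tie-breaking rule as above, non-adaptive Greedy is $(1-1/e)$-competitive in expectation against the adaptive offline benchmark: $$\mathbb{E}_{t_1,\dots,t_V\sim\mathcal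 V}\big[\mathrm{ALG}(t_1,\dots,t_V)\big]\ \ge\ \Big(1-\frac1e\Big)\,\mathbb{E}_{t_1,\dots,t_V\sim\mathcal V}\big[\mathrm{AOPT}(t_1,\dots,t_V)\big].$$ -/

import Mathlib

/-- The data of an instance of online submodular welfare maximization with configurations and
post-allocation stochasticity, for arrivals whose types are drawn from `T`; neither the number of
arrivals nor the distribution of the types is part of it.
`I` is the set of resources, `T` the set of arrival types. -/
structure OSWInstance (I T : Type*) [Fintype I] [DecidableEq I] [DecidableEq T] where
  /-- the feasible configurations `(R, t)` -/
  N : Finset (Finset I × T)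
  /-- objectives, on multisets of configurations, i.e. on the lattice of nonnegative integer
  vectors indexed by `N` -/
  f : I → ({e // e ∈ N} → ℕ) → ℝ
  f_zero : ∀ i, f i 0 = 0
  f_mono : ∀ i, Monotone (f i)
  /-- diminishing returns -/
  f_dr : ∀ i x y, y ≤ x → ∀ e,
    f i (x + Pi.single e 1) - f i x ≤ f i (y + Pi.single e 1) - f i y
  /-- a configuration `(R, t)` contributes only to the objectives of the resources in `R` -/
  f_local : ∀ i x, f i x = f i (fun e => if i ∈ e.1.1 then x e else 0)
  /-- `law e A` is the probability that, when `e = (R, t)` is chosen, `A` is the set of active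
  resources; the activities of different resources may be correlated arbitrarily -/
  law : {e // e ∈ N} → Finset I → ℝ
  law_nonneg : ∀ e A, 0 ≤ law e A
  law_sum : ∀ e, ∑ A, law e A = 1
  law_subset : ∀ e A, law e A ≠ 0 → A ⊆ e.1.1

namespace OSWInstance

variable {I T : Type*} [Fintype I] [DecidableEq I] [DecidableEq T]

/-- Feasible configurations `(R, t)`. -/
abbrev Config (G : OSWInstance I T) : Type _ := {e // e ∈ G.N}

/-- The activation probability `p_{i,e}`, the marginal probability that `i` is active in `e`. -/
noncomputable def p (G : OSWInstance I T) (i : I) (e : G.Config) : ℝ :=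
  ∑ A with i ∈ A, G.law e A

/-- The activation probability of `i` at an arrival at which the decision is `d` (`none`: no
configuration is chosen, and nothing is active). -/
noncomputable def actProb (G : OSWInstance I T) (i : I) (d : Option G.Config) : ℝ :=
  d.elim 0 (G.p i)

/-- If `c v` is the decision at arrival `v`, this is the multiset of the configurations that are
chosen at the arrivals in `X`. -/
def multiplicity (G : OSWInstance I T) {n : ℕ} (c : Fin n → Option G.Config)
    (X : Finset (Fin n)) : G.Config → ℕ :=
  fun e => (X.filter fun v => c v = some e).card

/-- The probability that `i` is active exactly at the arrivals in `X`, under the decisions `c`. -/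
noncomputable def gamma (G : OSWInstance I T) (i : I) {n : ℕ} (c : Fin n → Option G.Config)
    (X : Finset (Fin n)) : ℝ :=
  (∏ v ∈ X, G.actProb i (c v)) * ∏ v ∈ Xᶜ, (1 - G.actProb i (c v))

/-- The expected reward from resource `i` under the (non-adaptive) decisions `c`. -/
noncomputable def F (G : OSWInstance I T) (i : I) {n : ℕ} (c : Fin n → Option G.Config) : ℝ :=
  ∑ X : Finset (Fin n), G.gamma i c X * G.f i (G.multiplicity c X)

/-- The total marginal value of choosing `e` at the next arrival, after the decisions `c`. -/
noncomputable def marginal (G : OSWInstance I T) {n : ℕ} (c : Fin n → Option G.Config)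
    (e : G.Config) : ℝ :=
  ∑ i, (G.F i (Fin.snoc c (some e) : Fin (n + 1) → Option G.Config) - G.F i c)

/-- A deterministic online algorithm that is oblivious to the post-allocation outcomes: the
decision at an arrival is a function of the types of the arrivals up to and including it. -/
abbrev NonadaptiveAlg (G : OSWInstance I T) : Type _ :=
  (n : ℕ) → (Fin (n + 1) → T) → Option G.Config

/-- The decisions of the algorithm on the sequence of types `τ`. -/
def NonadaptiveAlg.run {G : OSWInstance I T} (g : G.NonadaptiveAlg) {n : ℕ} (τ : Fin n → T) :
    Fin n → Option G.Config :=
  fun v => g v (fun u => τ ⟨u, u.2.trans_le v.2⟩)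

/-- `g` is non-adaptive Greedy (with some tie-breaking): at an arrival of type `t` it chooses a
configuration of type `t` that maximizes the total marginal value with respect to its earlier
decisions, and it chooses nothing only if there is no configuration of type `t`. -/
def NonadaptiveAlg.IsGreedy {G : OSWInstance I T} (g : G.NonadaptiveAlg) : Prop :=
  ∀ (n : ℕ) (τ : Fin (n + 1) → T),
    (∀ e, g n τ = some e → e.1.2 = τ (Fin.last n) ∧
      ∀ e' : G.Config, e'.1.2 = τ (Fin.last n) →
        G.marginal (g.run (Fin.init τ)) e' ≤ G.marginal (g.run (Fin.init τ)) e) ∧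
    (g n τ = none → ∀ e : G.Config, e.1.2 ≠ τ (Fin.last n))

/-- The expected total reward (over the post-allocation outcomes) of a non-adaptive algorithm on
the sequence of types `τ`. -/
noncomputable def NonadaptiveAlg.value {G : OSWInstance I T} (g : G.NonadaptiveAlg) {n : ℕ}
    (τ : Fin n → T) : ℝ :=
  ∑ i, G.F i (g.run τ)

/-- An adaptive non-anticipative policy for `n` arrivals. It processes the arrivals one by one, in
an order of its choice: the pair of the arrival processed in step `k` and the decision made for it
is a function of the sets of active resources that were observed in the steps before `k`. -/
abbrev AdaptivePolicy (G : OSWInstance I T) (n : ℕ) : Type _ :=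
  (k : Fin n) → (Fin k → Finset I) → Fin n × Option G.Config

/-- The pairs of arrival and decision in the steps of the policy, when `ω k` is the set of active
resources in step `k`. -/
def AdaptivePolicy.run {G : OSWInstance I T} {n : ℕ} (π : G.AdaptivePolicy n)
    (ω : Fin n → Finset I) : Fin n → Fin n × Option G.Config :=
  fun k => π k (fun j => ω ⟨j, j.2.trans k.2⟩)

/-- The decisions in the steps of the policy. -/
def AdaptivePolicy.decision {G : OSWInstance I T} {n : ℕ} (π : G.AdaptivePolicy n)
    (ω : Fin n → Finset I) : Fin n → Option G.Config :=
  fun k => (π.run ω k).2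

/-- No arrival is processed twice, and each arrival receives a configuration of its type, if any. -/
def AdaptivePolicy.IsFeasible {G : OSWInstance I T} {n : ℕ} (π : G.AdaptivePolicy n)
    (τ : Fin n → T) : Prop :=
  ∀ ω, Function.Injective (fun k => (π.run ω k).1) ∧
    ∀ k e, (π.run ω k).2 = some e → e.1.2 = τ (π.run ω k).1

/-- The probability that `A` is the set of active resources at an arrival with decision `d`. -/
noncomputable def outcomeProb (G : OSWInstance I T) (d : Option G.Config) (A : Finset I) : ℝ :=
  d.elim (if A = ∅ then 1 else 0) (fun e => G.law e A)

/-- The expected total reward of an adaptive policy; the outcomes at different arrivals are independent. -/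
noncomputable def AdaptivePolicy.value {G : OSWInstance I T} {n : ℕ} (π : G.AdaptivePolicy n) :
    ℝ :=
  ∑ ω : Fin n → Finset I, (∏ k, G.outcomeProb (π.decision ω k) (ω k)) *
    ∑ i, G.f i (G.multiplicity (π.decision ω) {k | i ∈ ω k})

/-- The adaptive offline benchmark: the optimal expected total reward of an adaptive
non-anticipative policy that knows the instance and the whole sequence of types `τ`. -/
noncomputable def aopt (G : OSWInstance I T) {n : ℕ} (τ : Fin n → T) : ℝ :=
  sSup {r | ∃ π : G.AdaptivePolicy n, π.IsFeasible τ ∧ π.value = r}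

/-- The supremum in the definition of the benchmark is attained. -/
theorem isGreatest_aopt (G : OSWInstance I T) {n : ℕ} (τ : Fin n → T) :
    IsGreatest {r | ∃ π : G.AdaptivePolicy n, π.IsFeasible τ ∧ π.value = r} (G.aopt τ) := by
  have hfin : {r | ∃ π : G.AdaptivePolicy n, π.IsFeasible τ ∧ π.value = r}.Finite :=
    (Set.finite_range fun π : G.AdaptivePolicy n => π.value).subset
      (by rintro r ⟨π, -, rfl⟩; exact ⟨π, rfl⟩)
  have hne : {r | ∃ π : G.AdaptivePolicy n, π.IsFeasible τ ∧ π.value = r}.Nonempty :=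
    ⟨_, fun k _ => (k, none), fun _ => ⟨fun _ _ h => h, fun _ _ h => by cases h⟩, rfl⟩
  exact ⟨hne.csSup_mem hfin, fun r hr => le_csSup hfin.bddAbove hr⟩

end OSWInstance

/-- The expectation of `X` over sequences of `n` types drawn independently from the distribution
with point probabilities `q`. -/
def iidExpectation {T : Type*} [Fintype T] (q : T → ℝ) {n : ℕ} (X : (Fin n → T) → ℝ) : ℝ :=
  ∑ τ : Fin n → T, (∏ v, q (τ v)) * X τ

/-! Fix non-adaptive decisions `c` and run an adaptive policy on top of an independent realization
of `c`. Each decision is made before its active set is drawn, so resource `i` is active with its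
marginal probability, and diminishing returns bound the gain by the gain at the realization of `c`
alone. Hence the benchmark is at most the value of `c` plus, for each arrival, the best marginal
value with respect to `c` at its type (`aopt_le`), whatever the adaptive order.

Now let `c` be Greedy's decisions on `n` random types and give the benchmark a fresh independent
sample of `V` types. The best marginal at a type is what Greedy gains if that type comes next, and
every benchmark type is distributed like Greedy's next type. With `a n` the expected value of Greedy
after `n` arrivals and `b` the expected benchmark for `V`, this reads `b ≤ a n + V * (a (n + 1) - a
n)` (`iidExpectation_aopt_le`). The gap shrinks by the factor `1 - 1 / V` per arrival, and `(1 - 1 /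
V) ^ V ≤ 1 / e`. -/

/-! ### Splitting off the last coordinate -/

theorem Fin.sum_tuple_snoc {α M : Type*} [Fintype α] [AddCommMonoid M] {n : ℕ}
    (f : (Fin (n + 1) → α) → M) :
    ∑ x, f x = ∑ x : Fin n → α, ∑ a, f (Fin.snoc x a) := by
  rw [← (Fin.snocEquiv fun _ => α).sum_comp, Fintype.sum_prod_type, Finset.sum_comm]
  rfl

theorem Fin.sum_finset_castSucc {M : Type*} [AddCommMonoid M] {n : ℕ}
    (f : Finset (Fin (n + 1)) → M) :
    ∑ X, f X = ∑ X : Finset (Fin n), f (X.map Fin.castSuccEmb)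
      + ∑ X : Finset (Fin n), f (insert (Fin.last n) (X.map Fin.castSuccEmb)) := by
  have key : ∀ h : Finset (Fin (n + 1)) → M,
      ∑ X ∈ (Finset.univ.map Fin.castSuccEmb).powerset, h X
        = ∑ X : Finset (Fin n), h (X.map Fin.castSuccEmb) := by
    intro h
    symm
    refine Finset.sum_bij (fun X _ => X.map Fin.castSuccEmb) ?_ ?_ ?_ ?_
    · intro X _
      exact Finset.mem_powerset.2 (Finset.map_subset_map.2 (Finset.subset_univ X))
    · intro X _ Y _ hXY
      exact Finset.map_injective _ hXY
    · intro Y hY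
      obtain ⟨X, -, rfl⟩ := Finset.subset_map_iff.1 (Finset.mem_powerset.1 hY)
      exact ⟨X, Finset.mem_univ X, rfl⟩
    · intro X _
      rfl
  have huniv : (Finset.univ : Finset (Fin (n + 1)))
      = insert (Fin.last n) (Finset.univ.map Fin.castSuccEmb) := by
    ext v
    refine Fin.lastCases ?_ (fun u => ?_) v <;> simp
  rw [← Finset.powerset_univ, huniv, Finset.sum_powerset_insert (by simp), key, key]

/-! ### Expected rewards of non-adaptive decisions -/

namespace OSWInstance

variable {I T : Type*} [Fintype I] [DecidableEq I] [DecidableEq T] (G : OSWInstance I T)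

/-- The multiset of configurations that is chosen by a single decision. -/
def unitVec (d : Option G.Config) : G.Config → ℕ :=
  d.elim 0 fun e => Pi.single e 1

theorem multiplicity_eq_sum {n : ℕ} (c : Fin n → Option G.Config) (X : Finset (Fin n)) :
    G.multiplicity c X = ∑ v ∈ X, G.unitVec (c v) := by
  funext e
  rw [multiplicity, Finset.card_filter, Finset.sum_apply]
  refine Finset.sum_congr rfl fun v _ => ?_
  cases h : c v with
  | none => simp [unitVec]
  | some e' => simp [unitVec, Pi.single_apply, eq_comm]

theorem multiplicity_snoc_map {n : ℕ} (c : Fin n → Option G.Config) (d : Option G.Config)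
    (X : Finset (Fin n)) :
    G.multiplicity (Fin.snoc c d : Fin (n + 1) → Option G.Config) (X.map Fin.castSuccEmb)
      = G.multiplicity c X := by
  simp [multiplicity_eq_sum]

theorem multiplicity_snoc_insert {n : ℕ} (c : Fin n → Option G.Config) (d : Option G.Config)
    (X : Finset (Fin n)) :
    G.multiplicity (Fin.snoc c d : Fin (n + 1) → Option G.Config)
        (insert (Fin.last n) (X.map Fin.castSuccEmb))
      = G.multiplicity c X + G.unitVec d := by
  rw [multiplicity_eq_sum, Finset.sum_insert (by simp), add_comm]
  simp [multiplicity_eq_sum]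

theorem p_nonneg (i : I) (e : G.Config) : 0 ≤ G.p i e :=
  Finset.sum_nonneg fun A _ => G.law_nonneg e A

theorem p_le_one (i : I) (e : G.Config) : G.p i e ≤ 1 :=
  (Finset.sum_le_sum_of_subset_of_nonneg (Finset.filter_subset _ _)
    fun A _ _ => G.law_nonneg e A).trans_eq (G.law_sum e)

theorem actProb_nonneg (i : I) (d : Option G.Config) : 0 ≤ G.actProb i d := by
  cases d with
  | none => exact le_rfl
  | some e => exact G.p_nonneg i e

theorem actProb_le_one (i : I) (d : Option G.Config) : G.actProb i d ≤ 1 := by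
  cases d with
  | none => exact zero_le_one
  | some e => exact G.p_le_one i e

theorem gamma_nonneg (i : I) {n : ℕ} (c : Fin n → Option G.Config) (X : Finset (Fin n)) :
    0 ≤ G.gamma i c X :=
  mul_nonneg (Finset.prod_nonneg fun v _ => G.actProb_nonneg i (c v))
    (Finset.prod_nonneg fun v _ => sub_nonneg.2 (G.actProb_le_one i (c v)))

theorem F_nonneg (i : I) {n : ℕ} (c : Fin n → Option G.Config) : 0 ≤ G.F i c :=
  Finset.sum_nonneg fun X _ => mul_nonneg (G.gamma_nonneg i c X)
    ((G.f_zero i).symm.le.trans (G.f_mono i (zero_le (a := G.multiplicity c X))))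

theorem gamma_eq_prod (i : I) {n : ℕ} (c : Fin n → Option G.Config) (X : Finset (Fin n)) :
    G.gamma i c X
      = ∏ v, if v ∈ X then G.actProb i (c v) else 1 - G.actProb i (c v) := by
  rw [gamma, ← Finset.prod_mul_prod_compl X]
  congr 1
  · exact Finset.prod_congr rfl fun v hv => (if_pos hv).symm
  · exact Finset.prod_congr rfl fun v hv => (if_neg (Finset.mem_compl.1 hv)).symm

theorem gamma_snoc_map (i : I) {n : ℕ} (c : Fin n → Option G.Config) (d : Option G.Config)
    (X : Finset (Fin n)) :
    G.gamma i (Fin.snoc c d : Fin (n + 1) → Option G.Config) (X.map Fin.castSuccEmb)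
      = G.gamma i c X * (1 - G.actProb i d) := by
  simp [gamma_eq_prod, Fin.prod_univ_castSucc]

theorem gamma_snoc_insert (i : I) {n : ℕ} (c : Fin n → Option G.Config) (d : Option G.Config)
    (X : Finset (Fin n)) :
    G.gamma i (Fin.snoc c d : Fin (n + 1) → Option G.Config)
        (insert (Fin.last n) (X.map Fin.castSuccEmb))
      = G.gamma i c X * G.actProb i d := by
  simp [gamma_eq_prod, Fin.prod_univ_castSucc]

theorem sum_gamma (i : I) {n : ℕ} (c : Fin n → Option G.Config) :
    ∑ X, G.gamma i c X = 1 := by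
  simp only [gamma, Finset.compl_eq_univ_sdiff, ← Finset.powerset_univ]
  rw [← Finset.prod_add]
  simp

/-- The increase of the expected reward from `i` caused by one more decision. -/
theorem F_snoc_sub (i : I) {n : ℕ} (c : Fin n → Option G.Config) (d : Option G.Config) :
    G.F i (Fin.snoc c d : Fin (n + 1) → Option G.Config) - G.F i c
      = ∑ X, G.gamma i c X * (G.actProb i d *
          (G.f i (G.multiplicity c X + G.unitVec d) - G.f i (G.multiplicity c X))) := by
  rw [F, F, Fin.sum_finset_castSucc, ← Finset.sum_add_distrib, ← Finset.sum_sub_distrib]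
  refine Finset.sum_congr rfl fun X _ => ?_
  rw [gamma_snoc_map, gamma_snoc_insert, multiplicity_snoc_map, multiplicity_snoc_insert]
  ring

theorem F_snoc_none (i : I) {n : ℕ} (c : Fin n → Option G.Config) :
    G.F i (Fin.snoc c none : Fin (n + 1) → Option G.Config) = G.F i c := by
  rw [← sub_eq_zero, F_snoc_sub]
  simp [actProb]

theorem F_le_F_snoc (i : I) {n : ℕ} (c : Fin n → Option G.Config) (d : Option G.Config) :
    G.F i c ≤ G.F i (Fin.snoc c d : Fin (n + 1) → Option G.Config) := by
  rw [← sub_nonneg, F_snoc_sub]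
  exact Finset.sum_nonneg fun X _ => mul_nonneg (G.gamma_nonneg i c X)
    (mul_nonneg (G.actProb_nonneg i d) (sub_nonneg.2 (G.f_mono i le_self_add)))

theorem f_unitVec_dr (i : I) {x y : G.Config → ℕ} (hxy : y ≤ x) (d : Option G.Config) :
    G.f i (x + G.unitVec d) - G.f i x ≤ G.f i (y + G.unitVec d) - G.f i y := by
  cases d with
  | none => simp [unitVec]
  | some e => exact G.f_dr i x y hxy e

/-! ### Outcomes and adaptive decision rules -/

theorem outcomeProb_nonneg (d : Option G.Config) (A : Finset I) : 0 ≤ G.outcomeProb d A := by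
  cases d with
  | none => rw [outcomeProb, Option.elim_none]; split_ifs <;> norm_num
  | some e => exact G.law_nonneg e A

theorem sum_outcomeProb (d : Option G.Config) : ∑ A, G.outcomeProb d A = 1 := by
  cases d with
  | none => simp [outcomeProb]
  | some e => exact G.law_sum e

/-- Rewards are separate for each resource, so only marginal probabilities enter; correlations
within an active set disappear here. -/
theorem sum_outcomeProb_mem (i : I) (d : Option G.Config) :
    (∑ A, if i ∈ A then G.outcomeProb d A else 0) = G.actProb i d := by
  rw [← Finset.sum_filter]
  cases d with
  | none =>
    refine Finset.sum_eq_zero fun A hA => if_neg ?_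
    rintro rfl
    simp at hA
  | some e => rfl

/-- A non-anticipative rule for `m` successive decisions: the decision in step `k` is a function
of the sets of active resources in the steps before `k`. -/
abbrev DecisionRule (m : ℕ) : Type _ :=
  (k : Fin m) → (Fin k → Finset I) → Option G.Config

variable {G}

namespace DecisionRule

/-- The decisions of the rule when `ω k` is the set of active resources in step `k`. -/
def run {m : ℕ} (δ : G.DecisionRule m) (ω : Fin m → Finset I) : Fin m → Option G.Config :=
  fun k => δ k fun j => ω ⟨j, j.2.trans k.2⟩

/-- The rule without its last step. -/
def init {m : ℕ} (δ : G.DecisionRule (m + 1)) : G.DecisionRule m :=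
  fun k ω => δ k.castSucc ω

/-- The probability of the outcomes `ω` under the rule. -/
noncomputable def prob {m : ℕ} (δ : G.DecisionRule m) (ω : Fin m → Finset I) : ℝ :=
  ∏ k, G.outcomeProb (δ.run ω k) (ω k)

/-- This is non-anticipation: no decision reads the outcome of its own step, so the last active set
can be averaged out with the last decision held fixed. -/
theorem run_snoc {m : ℕ} (δ : G.DecisionRule (m + 1)) (ω : Fin m → Finset I) (A : Finset I) :
    δ.run (Fin.snoc ω A : Fin (m + 1) → Finset I)
      = (Fin.snoc (δ.init.run ω) (δ (Fin.last m) ω) : Fin (m + 1) → Option G.Config) := by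
  have h : ∀ j : Fin m,
      (Fin.snoc ω A : Fin (m + 1) → Finset I) ⟨j, j.2.trans (Nat.lt_succ_self m)⟩ = ω j :=
    fun j => Fin.snoc_castSucc (α := fun _ => Finset I) A ω j
  funext k
  refine Fin.lastCases ?_ (fun u => ?_) k
  · rw [Fin.snoc_last]
    exact congrArg (δ (Fin.last m)) (funext h)
  · rw [Fin.snoc_castSucc]
    exact congrArg (δ u.castSucc) (funext fun j => h ⟨j, j.2.trans u.2⟩)

theorem prob_snoc {m : ℕ} (δ : G.DecisionRule (m + 1)) (ω : Fin m → Finset I) (A : Finset I) :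
    δ.prob (Fin.snoc ω A : Fin (m + 1) → Finset I)
      = δ.init.prob ω * G.outcomeProb (δ (Fin.last m) ω) A := by
  simp only [prob, run_snoc, Fin.prod_univ_castSucc, Fin.snoc_castSucc, Fin.snoc_last]

theorem prob_nonneg {m : ℕ} (δ : G.DecisionRule m) (ω : Fin m → Finset I) : 0 ≤ δ.prob ω :=
  Finset.prod_nonneg fun _ _ => G.outcomeProb_nonneg _ _

theorem sum_prob {m : ℕ} (δ : G.DecisionRule m) : ∑ ω, δ.prob ω = 1 := by
  induction m with
  | zero => simp [prob]
  | succ m ih =>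
    simp only [Fin.sum_tuple_snoc, prob_snoc, ← Finset.mul_sum, sum_outcomeProb, mul_one, ih]

/-- The multiset of the configurations chosen by the rule in which `i` is active. -/
def active {m : ℕ} (δ : G.DecisionRule m) (i : I) (ω : Fin m → Finset I) : G.Config → ℕ :=
  G.multiplicity (δ.run ω) {k | i ∈ ω k}

theorem active_snoc {m : ℕ} (δ : G.DecisionRule (m + 1)) (i : I) (ω : Fin m → Finset I)
    (A : Finset I) :
    δ.active i (Fin.snoc ω A : Fin (m + 1) → Finset I)
      = δ.init.active i ω + if i ∈ A then G.unitVec (δ (Fin.last m) ω) else 0 := by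
  simp only [active, multiplicity_eq_sum, Finset.sum_filter, Fin.sum_univ_castSucc, run_snoc,
    Fin.snoc_castSucc, Fin.snoc_last]

/-- The expected reward from `i` of a non-anticipative rule, started at the multiset `x`, is at
most the reward of `x` plus the expected sum of the marginal rewards at `x`. -/
theorem sum_prob_mul_f_le {m : ℕ} (δ : G.DecisionRule m) (i : I) (x : G.Config → ℕ) :
    ∑ ω, δ.prob ω * G.f i (x + δ.active i ω)
      ≤ G.f i x + ∑ ω, δ.prob ω * ∑ k, G.actProb i (δ.run ω k) *
          (G.f i (x + G.unitVec (δ.run ω k)) - G.f i x) := by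
  induction m with
  | zero => simp [prob, active, multiplicity_eq_sum]
  | succ m ih =>
    have hlast : ∀ ω : Fin m → Finset I,
        ∑ A, G.outcomeProb (δ (Fin.last m) ω) A *
            G.f i (x + (δ.init.active i ω + if i ∈ A then G.unitVec (δ (Fin.last m) ω) else 0))
          ≤ G.f i (x + δ.init.active i ω) + G.actProb i (δ (Fin.last m) ω) *
              (G.f i (x + G.unitVec (δ (Fin.last m) ω)) - G.f i x) := by
      intro ω
      set d := δ (Fin.last m) ω
      set y := δ.init.active i ω
      have hsum : ∑ A, G.outcomeProb d A * G.f i (x + (y + if i ∈ A then G.unitVec d else 0))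
          = G.f i (x + y) + G.actProb i d * (G.f i (x + y + G.unitVec d) - G.f i (x + y)) := by
        -- Spreading `f i (x + y)` over the outcomes allows a comparison term by term in `A`.
        have hxy : G.f i (x + y) = ∑ A, G.outcomeProb d A * G.f i (x + y) := by
          rw [← Finset.sum_mul, G.sum_outcomeProb, one_mul]
        conv_rhs => arg 1; rw [hxy]
        rw [← sum_outcomeProb_mem, Finset.sum_mul, ← Finset.sum_add_distrib]
        refine Finset.sum_congr rfl fun A _ => ?_
        split_ifs
        · rw [← add_assoc]; ring
        · rw [add_zero]; ring
      rw [hsum]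
      -- Diminishing returns discard `y`, the rewards collected adaptively so far.
      exact add_le_add_right (mul_le_mul_of_nonneg_left (G.f_unitVec_dr i le_self_add d)
        (G.actProb_nonneg i d)) _
    have hle := Finset.sum_le_sum fun ω (_ : ω ∈ Finset.univ) =>
      mul_le_mul_of_nonneg_left (hlast ω) (δ.init.prob_nonneg ω)
    simp only [mul_add, Finset.sum_add_distrib] at hle
    -- The marginals at `x` do not involve the last outcome, so it sums out.
    have hR : ∀ ω : Fin m → Finset I,
        ∑ A, δ.init.prob ω * G.outcomeProb (δ (Fin.last m) ω) A *
            (∑ k, G.actProb i (δ.init.run ω k) *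
                (G.f i (x + G.unitVec (δ.init.run ω k)) - G.f i x)
              + G.actProb i (δ (Fin.last m) ω) *
                (G.f i (x + G.unitVec (δ (Fin.last m) ω)) - G.f i x))
          = δ.init.prob ω * (∑ k, G.actProb i (δ.init.run ω k) *
                (G.f i (x + G.unitVec (δ.init.run ω k)) - G.f i x))
            + δ.init.prob ω * (G.actProb i (δ (Fin.last m) ω) *
                (G.f i (x + G.unitVec (δ (Fin.last m) ω)) - G.f i x)) := by
      intro ω
      rw [← Finset.sum_mul, ← Finset.mul_sum, G.sum_outcomeProb, mul_one, mul_add]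
    simp only [Fin.sum_tuple_snoc, prob_snoc, active_snoc, run_snoc, Fin.sum_univ_castSucc,
      Fin.snoc_castSucc, Fin.snoc_last, hR]
    simp only [mul_assoc, ← Finset.mul_sum]
    rw [Finset.sum_add_distrib]
    linarith [hle, ih δ.init]

/-- Average the previous bound over starting multisets `x` given by an independent realization of
`c`; by monotonicity, adding `x` only increases the reward of the rule. -/
theorem sum_prob_mul_f_le_F {m n : ℕ} (δ : G.DecisionRule m) (i : I)
    (c : Fin n → Option G.Config) :
    ∑ ω, δ.prob ω * G.f i (δ.active i ω)
      ≤ G.F i c + ∑ ω, δ.prob ω * ∑ k,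
          (G.F i (Fin.snoc c (δ.run ω k) : Fin (n + 1) → Option G.Config) - G.F i c) := by
  calc ∑ ω, δ.prob ω * G.f i (δ.active i ω)
      = ∑ X, G.gamma i c X * ∑ ω, δ.prob ω * G.f i (δ.active i ω) := by
        rw [← Finset.sum_mul, G.sum_gamma, one_mul]
    _ ≤ ∑ X, G.gamma i c X * (G.f i (G.multiplicity c X) + ∑ ω, δ.prob ω * ∑ k,
          G.actProb i (δ.run ω k) * (G.f i (G.multiplicity c X + G.unitVec (δ.run ω k))
            - G.f i (G.multiplicity c X))) := by
        refine Finset.sum_le_sum fun X _ =>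
          mul_le_mul_of_nonneg_left (le_trans ?_ (δ.sum_prob_mul_f_le i _)) (G.gamma_nonneg i c X)
        exact Finset.sum_le_sum fun ω _ =>
          mul_le_mul_of_nonneg_left (G.f_mono i le_add_self) (δ.prob_nonneg ω)
    _ = _ := by
        simp only [mul_add, Finset.sum_add_distrib, F_snoc_sub]
        congr 1
        simp only [Finset.mul_sum]
        rw [Finset.sum_comm]
        refine Finset.sum_congr rfl fun ω _ => ?_
        rw [Finset.sum_comm]
        refine Finset.sum_congr rfl fun k _ => Finset.sum_congr rfl fun X _ => ?_
        ring

end DecisionRule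

/-! ### The benchmark against Greedy's marginals -/

/-- The benchmark is at most the value of any non-adaptive decisions `c` plus the sum over the
arrivals of upper bounds on the marginal values with respect to `c`. -/
theorem aopt_le {n m : ℕ} (τ : Fin n → T) (c : Fin m → Option G.Config) (w : T → ℝ)
    (hw : ∀ t, 0 ≤ w t) (hcw : ∀ e : G.Config, G.marginal c e ≤ w e.1.2) :
    G.aopt τ ≤ ∑ i, G.F i c + ∑ v, w (τ v) := by
  obtain ⟨π, hπ, hval⟩ := (G.isGreatest_aopt τ).1
  rw [← hval]
  set δ : G.DecisionRule n := fun k ω => (π k ω).2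
  have hstep : ∀ ω, ∑ i, ∑ k,
      (G.F i (Fin.snoc c (δ.run ω k) : Fin (m + 1) → Option G.Config) - G.F i c)
        ≤ ∑ v, w (τ v) := by
    intro ω
    obtain ⟨hinj, htype⟩ := hπ ω
    -- There are as many steps as arrivals, so the injective processing order is a permutation.
    -- Steps without a configuration are absorbed by `0 ≤ w`.
    rw [Finset.sum_comm, ← (Equiv.ofBijective _ (Finite.injective_iff_bijective.1 hinj)).sum_comp
      fun v => w (τ v)]
    refine Finset.sum_le_sum fun k _ => ?_
    change _ ≤ w (τ (π.run ω k).1)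
    cases hd : δ.run ω k with
    | none => simpa [F_snoc_none] using hw _
    | some e =>
      rw [← htype k e hd]
      exact hcw e
  calc π.value = ∑ i, ∑ ω, δ.prob ω * G.f i (δ.active i ω) := by
        rw [Finset.sum_comm]
        simp only [← Finset.mul_sum]
        rfl
    _ ≤ ∑ i, (G.F i c + ∑ ω, δ.prob ω * ∑ k,
          (G.F i (Fin.snoc c (δ.run ω k) : Fin (m + 1) → Option G.Config) - G.F i c)) :=
        Finset.sum_le_sum fun i _ => δ.sum_prob_mul_f_le_F i c
    _ = ∑ i, G.F i c + ∑ ω, δ.prob ω * ∑ i, ∑ k,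
          (G.F i (Fin.snoc c (δ.run ω k) : Fin (m + 1) → Option G.Config) - G.F i c) := by
        rw [Finset.sum_add_distrib, Finset.sum_comm (s := Finset.univ (α := I))]
        simp only [← Finset.mul_sum]
    _ ≤ ∑ i, G.F i c + ∑ ω, δ.prob ω * ∑ v, w (τ v) := by
        gcongr with ω
        · exact δ.prob_nonneg ω
        · exact hstep ω
    _ = _ := by rw [← Finset.sum_mul, δ.sum_prob, one_mul]

theorem aopt_nonneg {n : ℕ} (τ : Fin n → T) : 0 ≤ G.aopt τ := by
  refine (G.isGreatest_aopt τ).2 ⟨fun k _ => (k, none), fun _ =>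
    ⟨fun _ _ h => h, fun _ _ h => by cases h⟩, ?_⟩
  refine Finset.sum_eq_zero fun ω _ => mul_eq_zero_of_right _ (Finset.sum_eq_zero fun i _ => ?_)
  rw [← G.f_zero i, multiplicity_eq_sum]
  exact congrArg _ (Finset.sum_eq_zero fun _ _ => rfl)

theorem NonadaptiveAlg.run_snoc (g : G.NonadaptiveAlg) {n : ℕ} (τ : Fin n → T) (t : T) :
    g.run (Fin.snoc τ t : Fin (n + 1) → T)
      = (Fin.snoc (g.run τ) (g n (Fin.snoc τ t)) : Fin (n + 1) → Option G.Config) := by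
  funext k
  refine Fin.lastCases ?_ (fun u => ?_) k
  · rw [Fin.snoc_last]
    rfl
  · rw [Fin.snoc_castSucc]
    exact congrArg (g u) (funext fun j =>
      Fin.snoc_castSucc (α := fun _ => T) t τ ⟨j, j.2.trans_le u.2⟩)

theorem NonadaptiveAlg.value_snoc_sub_nonneg (g : G.NonadaptiveAlg) {n : ℕ} (τ : Fin n → T)
    (t : T) : 0 ≤ g.value (Fin.snoc τ t : Fin (n + 1) → T) - g.value τ := by
  rw [sub_nonneg, value, value, run_snoc]
  exact Finset.sum_le_sum fun i _ => G.F_le_F_snoc i _ _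

/-- Makes Greedy's gain at a hypothetical next arrival an admissible weight `w` in `aopt_le`. Greedy
cannot choose nothing here, as `e` itself is available. -/
theorem NonadaptiveAlg.IsGreedy.marginal_le {g : G.NonadaptiveAlg} (hg : g.IsGreedy) {n : ℕ}
    (τ : Fin n → T) (e : G.Config) :
    G.marginal (g.run τ) e
      ≤ g.value (Fin.snoc τ e.1.2 : Fin (n + 1) → T) - g.value τ := by
  have h := hg n (Fin.snoc τ e.1.2)
  rw [Fin.snoc_last, Fin.init_snoc] at h
  rw [NonadaptiveAlg.value, NonadaptiveAlg.value, NonadaptiveAlg.run_snoc,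
    ← Finset.sum_sub_distrib]
  cases hd : g n (Fin.snoc τ e.1.2) with
  | none => exact absurd rfl (h.2 hd e)
  | some e' => exact (h.1 e' hd).2 e rfl

end OSWInstance

/-! ### Expectations over independent types -/

section iidExpectation

variable {T : Type*} [Fintype T] {q : T → ℝ}

theorem iidExpectation_succ {n : ℕ} (X : (Fin (n + 1) → T) → ℝ) :
    iidExpectation q X
      = iidExpectation q fun τ : Fin n → T => ∑ t, q t * X (Fin.snoc τ t) := by
  simp only [iidExpectation, Fin.sum_tuple_snoc, Fin.prod_univ_castSucc, Fin.snoc_castSucc,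
    Fin.snoc_last, Finset.mul_sum, mul_assoc]

theorem iidExpectation_add {n : ℕ} (X Y : (Fin n → T) → ℝ) :
    iidExpectation q (fun τ => X τ + Y τ) = iidExpectation q X + iidExpectation q Y := by
  simp only [iidExpectation, mul_add, Finset.sum_add_distrib]

theorem iidExpectation_mul {n : ℕ} (a : ℝ) (X : (Fin n → T) → ℝ) :
    iidExpectation q (fun τ => a * X τ) = a * iidExpectation q X := by
  simp only [iidExpectation, Finset.mul_sum]
  exact Finset.sum_congr rfl fun τ _ => mul_left_comm _ _ _

theorem iidExpectation_mono (hq : q ∈ stdSimplex ℝ T) {n : ℕ} {X Y : (Fin n → T) → ℝ}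
    (h : ∀ τ, X τ ≤ Y τ) : iidExpectation q X ≤ iidExpectation q Y :=
  Finset.sum_le_sum fun τ _ =>
    mul_le_mul_of_nonneg_left (h τ) (Finset.prod_nonneg fun v _ => hq.1 (τ v))

theorem iidExpectation_const (hq : q ∈ stdSimplex ℝ T) (n : ℕ) (a : ℝ) :
    iidExpectation q (fun _ : Fin n → T => a) = a := by
  induction n with
  | zero => simp [iidExpectation]
  | succ n ih => rw [iidExpectation_succ, ← Finset.sum_mul, hq.2, one_mul, ih]

theorem iidExpectation_sum (hq : q ∈ stdSimplex ℝ T) (n : ℕ) (w : T → ℝ) :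
    iidExpectation q (fun τ : Fin n → T => ∑ v, w (τ v)) = n * ∑ t, q t * w t := by
  induction n with
  | zero => simp [iidExpectation]
  | succ n ih =>
    simp only [iidExpectation_succ, Fin.sum_univ_castSucc, Fin.snoc_castSucc, Fin.snoc_last,
      mul_add, Finset.sum_add_distrib, ← Finset.sum_mul, hq.2, one_mul]
    rw [iidExpectation_add, ih, iidExpectation_const hq]
    push_cast
    ring

end iidExpectation

/-! ### The recursion for the gap and the competitive ratio -/

/-- Each arrival closes at least the fraction `1 / V` of the expected gap between Greedy and the
benchmark for `V` arrivals. -/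
theorem OSWInstance.NonadaptiveAlg.IsGreedy.iidExpectation_aopt_le {I T : Type*} [Fintype I]
    [DecidableEq I] [Fintype T] [DecidableEq T] {G : OSWInstance I T} {g : G.NonadaptiveAlg}
    (hg : g.IsGreedy) {q : T → ℝ} (hq : q ∈ stdSimplex ℝ T) (V n : ℕ) :
    iidExpectation q (fun τ : Fin V → T => G.aopt τ)
      ≤ iidExpectation q (fun τ : Fin n → T => g.value τ)
        + V * (iidExpectation q (fun τ : Fin (n + 1) → T => g.value τ)
          - iidExpectation q (fun τ : Fin n → T => g.value τ)) := by
  -- Greedy's history `τ` is frozen while the benchmark's types are averaged independently of it.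
  have h : ∀ τ : Fin n → T, iidExpectation q (fun τ : Fin V → T => G.aopt τ)
      ≤ g.value τ + V * (∑ t, q t * g.value (Fin.snoc τ t : Fin (n + 1) → T)
          + (-1) * g.value τ) := by
    intro τ
    refine (iidExpectation_mono hq fun σ => aopt_le σ (g.run τ) _
      (g.value_snoc_sub_nonneg τ) (hg.marginal_le τ)).trans_eq ?_
    rw [iidExpectation_add, iidExpectation_const hq, iidExpectation_sum hq V fun t =>
      g.value (Fin.snoc τ t : Fin (n + 1) → T) - g.value τ]
    simp only [mul_sub, Finset.sum_sub_distrib, ← Finset.sum_mul, hq.2]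
    rw [NonadaptiveAlg.value]
    ring
  -- Averaging over `τ` merges the history and the next type into `n + 1` independent types.
  have h' := iidExpectation_mono hq h
  rw [iidExpectation_const hq, iidExpectation_add, iidExpectation_mul, iidExpectation_add,
    iidExpectation_mul, ← iidExpectation_succ (n := n) fun τ => g.value τ] at h'
  linarith

/-- A sequence that starts above `0` and closes at least the fraction `1 / V` of its gap to `b` in
each step reaches `(1 - 1 / e) * b` after `V` steps. -/
theorem one_sub_inv_exp_mul_le {a : ℕ → ℝ} {b : ℝ} (V : ℕ) (hb : 0 ≤ b) (ha : 0 ≤ a 0)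
    (h : ∀ n, b ≤ a n + V * (a (n + 1) - a n)) : (1 - 1 / Real.exp 1) * b ≤ a V := by
  -- For `V = 0` there is no contraction factor, but the hypothesis already gives `b ≤ a 0`.
  rcases Nat.eq_zero_or_pos V with rfl | hV
  · have h0 := h 0
    have : 0 ≤ 1 / Real.exp 1 * b := by positivity
    simp only [Nat.cast_zero, zero_mul, add_zero] at h0
    linarith
  have hV' : (1 : ℝ) ≤ V := by exact_mod_cast hV
  have hfrac : (0 : ℝ) ≤ 1 - 1 / V := by
    rw [sub_nonneg, div_le_one (by linarith)]
    exact hV'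
  have hgap : ∀ n, b - a n ≤ (1 - 1 / (V : ℝ)) ^ n * b := by
    intro n
    induction n with
    | zero => simpa using ha
    | succ n ih =>
      have hn : (b - a n) / V ≤ a (n + 1) - a n := by
        rw [div_le_iff₀ (by linarith)]
        linarith [h n]
      calc b - a (n + 1) ≤ (1 - 1 / (V : ℝ)) * (b - a n) := by
            have : (1 - 1 / (V : ℝ)) * (b - a n) = b - a n - (b - a n) / V := by ring
            linarith
        _ ≤ (1 - 1 / (V : ℝ)) * ((1 - 1 / (V : ℝ)) ^ n * b) :=
            mul_le_mul_of_nonneg_left ih hfrac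
        _ = _ := by ring
  have hexp : (1 - 1 / (V : ℝ)) ^ V ≤ 1 / Real.exp 1 := by
    rw [one_div (Real.exp 1), ← Real.exp_neg]
    exact Real.one_sub_div_pow_le_exp_neg hV'
  linarith [hgap V, mul_le_mul_of_nonneg_right hexp hb]

theorem mainTheorem4 {I T : Type*} [Fintype I] [DecidableEq I] [Fintype T] [DecidableEq T]
    (G : OSWInstance I T) (g : G.NonadaptiveAlg) (hg : g.IsGreedy)
    (V : ℕ) (q : T → ℝ) (hq : q ∈ stdSimplex ℝ T) :
    (1 - 1 / Real.exp 1) * iidExpectation q (fun τ : Fin V → T => G.aopt τ)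
      ≤ iidExpectation q (fun τ : Fin V → T => g.value τ) := by
  -- Greedy does not depend on `V`, so its length `n` varies while the benchmark stays at `V`
  -- arrivals.
  refine one_sub_inv_exp_mul_le (a := fun n => iidExpectation q fun τ : Fin n → T => g.value τ) V
    ?_ ?_ fun n => hg.iidExpectation_aopt_le hq V n
  · rw [← iidExpectation_const hq V 0]
    exact iidExpectation_mono hq fun τ => OSWInstance.aopt_nonneg τ
  · rw [← iidExpectation_const hq 0 0]
    exact iidExpectation_mono hq fun τ => Finset.sum_nonneg fun i _ => G.F_nonneg i _
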